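/- Let $q^{(1)},q^{(2)}$ be two probability vectors on $\{0,1,2,3\}$ with $q^{(1)}_\alpha+q^{(2)}_\alpha>0$ for every $\alpha$, let $\sigma_0=I,\sigma_1,\sigma_2,\sigma_3$ be the identity and the Pauli matrices $\sigma_x,\sigma_y,\sigma_z$, and consider the two qubit Pauli channels $\mathcal E_i(\rho)=\sum_{\alpha=0}^3 q^{(i)}_\alpha\,\sigma_\alpha\rho\,\sigma_\alpha$, $i=1,2$. For states $\rho_1,\rho_2$ put $$R_M(\rho_1,\rho_2)=\min_{(M_1,M_2)}\max\{\mathrm{Tr}[\rho_1M_2],\mathrm{Tr}[\rho_2M_1]\},\qquad R_B(\rho_1,\rho_2;p)=\min_{(M_1,M_2)}\bigl(p\,\mathrm{Tr}[\rho_1M_2]+(1-p)\,\mathrm{Tr}[\rho_2M_1]\bigr),$$ the minima being over two-outcome POVMs ($M_1,M_2\ge0$, $M_1+M_2=I$). Define the minimax risk without ancilla $\mathcal R'_M=\min_\rho R_M(\mathcal E_1(\rho),\mathcal E_2(\rho))$ over qubit states $\rho$, the minimax risk using entanglement $\mathcal R_M=\min_\xi R_M((\mathcal E_1\otimes\mathcal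 I)(\xi),(\mathcal E_2\otimes\mathcal I)(\xi))$ over states $\xi$ of the qubit together with an ancilla of arbitrary finite dimension, and likewise the Bayes risk $\mathcal R_B(p)=\min_\xi R_B((\mathcal E_1\otimes\mathcal I)(\xi),(\mathcal E_2\otimes\mathcal I)(\xi);p)$ for prior probabilities $(p,1-p)$. Put $t_\alpha=q^{(1)}_\alpha+q^{(2)}_\alpha$ and $p^{(\alpha)}=q^{(2)}_\alpha/t_\alpha$, and relabel the indices so that $p^{(0)}\le p^{(1)}\le p^{(2)}\le p^{(3)}$. Then the maximum of $\mathcal R_B$ over $[0,1]$ is attained at one of the points $p^{(\alpha)}$. Let $p_*$ be any of the points $p^{(\alpha)}$ at which it is attained. Then $\mathcal R'_M>\mathcal R_M$, except in the following cases, in each of which $\mathcal R'_M=\mathcal R_M$: - the two channels are the same; - $p_*=p^{(0)}=p^{(1)}<p^{(2)}$; - $p_*=p^{(0)}=p^{(1)}=p^{(2)}<p^{(3)}$ and $t_3+2\min_{\alpha=0,1,2}t_\alpha\le\sum_{\alpha=0,1,2}t_\alpha$; - $p^{(0)}<p_*=p^{(1)}<p^{(2)}$ and $t_0+t_1=t_2+t_3$;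 - $p^{(0)}<p_*=p^{(1)}=p^{(2)}<p^{(3)}$ and $|t_0-t_3|\le|t_1-t_2|$; - the cases obtained from these by exchanging the two channels, that is, by replacing $p_*$ by $1-p_*$, each $p^{(\alpha)}$ by $1-p^{(3-\alpha)}$ and each $t_\alpha$ by $t_{3-\alpha}$. -/

import Mathlib

open scoped Matrix ComplexOrder

noncomputable section

/-- A density matrix: positive semidefinite with unit trace. -/
def IsState {m : Type} [Fintype m] (ρ : Matrix m m ℂ) : Prop :=
  ρ.PosSemidef ∧ ρ.trace = 1

/-- A two-outcome positive operator-valued measure. -/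
def IsBinaryPOVM {m : Type} [DecidableEq m] (M₁ M₂ : Matrix m m ℂ) : Prop :=
  M₁.PosSemidef ∧ M₂.PosSemidef ∧ M₁ + M₂ = 1

/-- The probability `Tr[ρ M]` of the outcome `M` in the state `ρ`. -/
def outcomeProb {m : Type} [Fintype m] (ρ M : Matrix m m ℂ) : ℝ :=
  (ρ * M).trace.re

/-- Minimax risk in the discrimination of two states: the least possible value of the larger
of the two error probabilities. -/
def stateMinimaxRisk {m : Type} [Fintype m] [DecidableEq m] (ρ₁ ρ₂ : Matrix m m ℂ) : ℝ :=
  sInf {x | ∃ M₁ M₂ : Matrix m m ℂ, IsBinaryPOVM M₁ M₂ ∧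
    x = max (outcomeProb ρ₁ M₂) (outcomeProb ρ₂ M₁)}

/-- Bayes risk in the discrimination of two states with prior probabilities `p` and `1 - p`. -/
def stateBayesRisk {m : Type} [Fintype m] [DecidableEq m] (ρ₁ ρ₂ : Matrix m m ℂ) (p : ℝ) : ℝ :=
  sInf {x | ∃ M₁ M₂ : Matrix m m ℂ, IsBinaryPOVM M₁ M₂ ∧
    x = p * outcomeProb ρ₁ M₂ + (1 - p) * outcomeProb ρ₂ M₁}

/-- Linear maps on the operators of a qubit. -/
abbrev QubitMap : Type := Matrix (Fin 2) (Fin 2) ℂ →ₗ[ℂ] Matrix (Fin 2) (Fin 2) ℂ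

/-- The Pauli matrices `I`, `σ_x`, `σ_y`, `σ_z`. -/
def pauli : Fin 4 → Matrix (Fin 2) (Fin 2) ℂ :=
  ![1, !![0, 1; 1, 0], !![0, -Complex.I; Complex.I, 0], !![1, 0; 0, -1]]

/-- The Pauli channel `ρ ↦ ∑ α, q α • (σ_α * ρ * σ_α)`. -/
def pauliChannel (q : Fin 4 → ℝ) : QubitMap :=
  ∑ α, (q α : ℂ) • LinearMap.mulLeftRight ℂ (pauli α, pauli α)

/-- `(E ⊗ id) ξ`: the map `E` acts on the qubit, the identity acts on the ancilla `ℂⁿ`. -/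
def extend (E : QubitMap) {n : ℕ} (ξ : Matrix (Fin 2 × Fin n) (Fin 2 × Fin n) ℂ) :
    Matrix (Fin 2 × Fin n) (Fin 2 × Fin n) ℂ :=
  Matrix.of fun i j => E (Matrix.of fun a b => ξ (a, i.2) (b, j.2)) i.1 j.1

/-- Minimax risk for two maps without ancilla. -/
def minimaxRiskNoAncilla (E₁ E₂ : QubitMap) : ℝ :=
  sInf {x | ∃ ρ : Matrix (Fin 2) (Fin 2) ℂ, IsState ρ ∧ x = stateMinimaxRisk (E₁ ρ) (E₂ ρ)}

/-- Minimax risk for two maps, with input states entangled with an ancilla of any finite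
dimension. -/
def minimaxRisk (E₁ E₂ : QubitMap) : ℝ :=
  sInf {x | ∃ (n : ℕ) (ξ : Matrix (Fin 2 × Fin n) (Fin 2 × Fin n) ℂ), IsState ξ ∧
    x = stateMinimaxRisk (extend E₁ ξ) (extend E₂ ξ)}

/-- Bayes risk for two maps with priors `p` and `1 - p`, with input states entangled with an
ancilla of any finite dimension. -/
def bayesRisk (E₁ E₂ : QubitMap) (p : ℝ) : ℝ :=
  sInf {x | ∃ (n : ℕ) (ξ : Matrix (Fin 2 × Fin n) (Fin 2 × Fin n) ℂ), IsState ξ ∧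
    x = stateBayesRisk (extend E₁ ξ) (extend E₂ ξ) p}

/-- The nontrivial exceptional configurations of the ordered breakpoints `p 0 ≤ ⋯ ≤ p 3`, the
slopes `t` and the worst prior `ps`, up to exchanging the two channels. -/
def ExceptionalCase (t p : Fin 4 → ℝ) (ps : ℝ) : Prop :=
  (ps = p 0 ∧ p 0 = p 1 ∧ p 1 < p 2) ∨
  (ps = p 0 ∧ p 0 = p 1 ∧ p 1 = p 2 ∧ p 2 < p 3 ∧
    t 3 + 2 * min (t 0) (min (t 1) (t 2)) ≤ t 0 + t 1 + t 2) ∨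
  (p 0 < ps ∧ ps = p 1 ∧ p 1 < p 2 ∧ t 0 + t 1 = t 2 + t 3) ∨
  (p 0 < ps ∧ ps = p 1 ∧ p 1 = p 2 ∧ p 2 < p 3 ∧ |t 0 - t 3| ≤ |t 1 - t 2|)

/-- All exceptional configurations: equal channels, the cases above, and the cases obtained from
them by exchanging the two channels, which replaces each prior by its complement and
reverses the order of the indices. -/
def Exceptional (E₁ E₂ : QubitMap) (t p : Fin 4 → ℝ) (ps : ℝ) : Prop :=
  E₁ = E₂ ∨ ExceptionalCase t p ps ∨
    ExceptionalCase (fun α => t α.rev) (fun α => 1 - p α.rev) (1 - ps)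

end

open scoped Kronecker

/-! An input state and a POVM enter the risks only through a test `x`, where `x α` is the
probability of deciding for the second channel when the Pauli error is `α`. With an ancilla every
point of the cube `[0,1]^4` occurs, because the Pauli errors send a Bell state to four orthogonal
states (`exists_povm_bell`). Without ancilla the tests that occur are exactly those with `2 * x α ≤
∑ β, x β` and the same inequalities for `1 - x` (`mem_localPauliTests_outcomeProb`,
`exists_state_povm`).

What remains is a classical problem. The mean error at prior `s` is affine in `x` with coefficients
`t α * (s - p α)`, so the Bayes tests are the threshold tests at `s`, free only at indices with `p α
= s`. A weighted median gives a threshold test at some `p k` with equal error probabilities, that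
is, with `∑ α, t α * x α = 1`. Such an equalizer shows that `p k` is a worst prior, and at any worst
prior the minimax tests are exactly the balanced threshold tests (`minimax_of_isMaxOn`). The two
minimax risks therefore agree if and only if one of these tests satisfies the ancilla-free
inequalities; solving these linear constraints gives the list of exceptions (`exists_local_iff`). -/

/-- The infimum of a family of infima is the least element of the union of the family. -/
theorem sInf_setOf_sInf_eq {ι : Type} {P : ι → Prop} {B : ι → Set ℝ} {V : Set ℝ} {m : ℝ}
    (hm : IsLeast V m) (hne : ∀ i, P i → (B i).Nonempty) (hsub : ∀ i, P i → B i ⊆ V)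
    (hmem : ∃ i, P i ∧ m ∈ B i) : sInf {x | ∃ i, P i ∧ x = sInf (B i)} = m := by
  apply IsLeast.csInf_eq
  constructor
  · obtain ⟨i, hi, hmi⟩ := hmem
    exact ⟨i, hi, (IsLeast.csInf_eq ⟨hmi, fun y hy => hm.2 (hsub i hi hy)⟩).symm⟩
  · rintro x ⟨i, hi, rfl⟩
    exact le_csInf (hne i hi) fun y hy => hm.2 (hsub i hi hy)

/-! ### Classical tests on the Pauli index -/

/-- Randomized tests on the four Pauli indices: `x α` is the probability of deciding for the
second channel when the Pauli error is `α`. -/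
def pauliTests : Set (Fin 4 → ℝ) := Set.Icc 0 1

/-- The tests that can be realized without an ancilla. -/
def localPauliTests : Set (Fin 4 → ℝ) :=
  {x | x ∈ pauliTests ∧ (∀ α, 2 * x α ≤ ∑ β, x β) ∧ ∀ α, 2 * (1 - x α) ≤ ∑ β, (1 - x β)}

/-- Larger of the two error probabilities of a test. -/
def testRisk (q₁ q₂ : Fin 4 → ℝ) (x : Fin 4 → ℝ) : ℝ :=
  max (∑ α, q₁ α * x α) (∑ α, q₂ α * (1 - x α))

/-- Mean error probability of a test. -/
def testBayes (q₁ q₂ : Fin 4 → ℝ) (s : ℝ) (x : Fin 4 → ℝ) : ℝ :=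
  s * ∑ α, q₁ α * x α + (1 - s) * ∑ α, q₂ α * (1 - x α)

theorem mem_pauliTests {x : Fin 4 → ℝ} : x ∈ pauliTests ↔ ∀ α, 0 ≤ x α ∧ x α ≤ 1 := by
  simp [pauliTests, Set.mem_Icc, Pi.le_def, forall_and]

theorem isCompact_pauliTests : IsCompact pauliTests := isCompact_Icc

theorem isCompact_localPauliTests : IsCompact localPauliTests := by
  have h : localPauliTests = pauliTests ∩ ((⋂ α, {x | 2 * x α ≤ ∑ β, x β}) ∩
      ⋂ α, {x | 2 * (1 - x α) ≤ ∑ β, (1 - x β)}) := by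
    ext x; simp only [localPauliTests, Set.mem_ofPred_eq, Set.mem_inter_iff, Set.mem_iInter]
  rw [h]
  refine isCompact_pauliTests.inter_right (IsClosed.inter ?_ ?_)
  · exact isClosed_iInter fun α => isClosed_le (by fun_prop) (by fun_prop)
  · exact isClosed_iInter fun α => isClosed_le (by fun_prop) (by fun_prop)

theorem half_mem_localPauliTests : (fun _ => 1 / 2) ∈ localPauliTests := by
  refine ⟨mem_pauliTests.2 fun α => by norm_num, fun α => by norm_num, fun α => by norm_num⟩

theorem continuous_testRisk (q₁ q₂ : Fin 4 → ℝ) : Continuous (testRisk q₁ q₂) := by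
  unfold testRisk; fun_prop

theorem continuous_testBayes (q₁ q₂ : Fin 4 → ℝ) (s : ℝ) : Continuous (testBayes q₁ q₂ s) := by
  unfold testBayes; fun_prop

/-! ### Measurements as classical tests -/

section Quantum

variable {m : Type} [Fintype m] [DecidableEq m]

open scoped MatrixOrder in
theorem outcomeProb_nonneg {ρ M : Matrix m m ℂ} (hρ : ρ.PosSemidef) (hM : M.PosSemidef) :
    0 ≤ outcomeProb ρ M := by
  obtain ⟨B, rfl⟩ := CStarAlgebra.nonneg_iff_eq_star_mul_self.mp hM.nonneg
  unfold outcomeProb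
  rw [← mul_assoc, Matrix.trace_mul_comm, ← mul_assoc]
  have := (hρ.mul_mul_conjTranspose_same B).trace_nonneg
  exact (Complex.le_def.1 this).1

theorem outcomeProb_sum_smul {m : Type} [Fintype m] (q : Fin 4 → ℝ) (ρ : Fin 4 → Matrix m m ℂ) (M : Matrix m m ℂ) :
    outcomeProb (∑ α, (q α : ℂ) • ρ α) M = ∑ α, q α * outcomeProb (ρ α) M := by
  simp [outcomeProb, Finset.sum_mul, Matrix.trace_sum, Matrix.trace_smul]

theorem outcomeProb_add {M₁ M₂ ρ : Matrix m m ℂ} (hρ : IsState ρ) (h : IsBinaryPOVM M₁ M₂) :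
    outcomeProb ρ M₁ = 1 - outcomeProb ρ M₂ := by
  have h1 : outcomeProb ρ M₁ + outcomeProb ρ M₂ = outcomeProb ρ (M₁ + M₂) := by
    simp [outcomeProb, Matrix.mul_add]
  have h2 : outcomeProb ρ (1 : Matrix m m ℂ) = 1 := by simp [outcomeProb, hρ.2]
  rw [h.2.2, h2] at h1
  linarith

theorem IsState.conj {ρ U : Matrix m m ℂ} (hρ : IsState ρ) (hU : U.IsHermitian)
    (hUU : U * U = 1) : IsState (U * ρ * U) := by
  constructor
  · have := hρ.1.mul_mul_conjTranspose_same U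
    rwa [hU.eq] at this
  · rw [Matrix.trace_mul_comm, ← mul_assoc, hUU, one_mul, hρ.2]

theorem isBinaryPOVM_one_zero {m : Type} [DecidableEq m] :
    IsBinaryPOVM (1 : Matrix m m ℂ) 0 :=
  ⟨Matrix.PosSemidef.one, Matrix.PosSemidef.zero, add_zero _⟩

/-- A POVM on a family of four states is a test on the index. -/
theorem mem_pauliTests_outcomeProb {ρ : Fin 4 → Matrix m m ℂ} (hρ : ∀ α, IsState (ρ α))
    {M₁ M₂ : Matrix m m ℂ} (h : IsBinaryPOVM M₁ M₂) :
    (fun α => outcomeProb (ρ α) M₂) ∈ pauliTests := by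
  refine mem_pauliTests.2 fun α => ⟨outcomeProb_nonneg (hρ α).1 h.2.1, ?_⟩
  have h1 := outcomeProb_nonneg (hρ α).1 h.1
  have h2 := outcomeProb_add (hρ α) h
  linarith

end Quantum

/-! ### Pauli errors and Bell states: the risks with an ancilla -/

theorem pauli_isHermitian (α : Fin 4) : (pauli α).IsHermitian := by
  ext i j
  fin_cases α <;> fin_cases i <;> fin_cases j <;> simp [pauli]

theorem pauli_mul_self (α : Fin 4) : pauli α * pauli α = 1 := by
  ext i j
  fin_cases α <;> fin_cases i <;> fin_cases j <;> simp [pauli, Matrix.mul_apply]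

theorem pauliChannel_apply (q : Fin 4 → ℝ) (ρ : Matrix (Fin 2) (Fin 2) ℂ) :
    pauliChannel q ρ = ∑ α, (q α : ℂ) • (pauli α * ρ * pauli α) := by
  simp [pauliChannel, LinearMap.sum_apply]

theorem isState_pauli {ρ : Matrix (Fin 2) (Fin 2) ℂ} (hρ : IsState ρ) (α : Fin 4) :
    IsState (pauli α * ρ * pauli α) :=
  hρ.conj (pauli_isHermitian α) (pauli_mul_self α)

/-- The Pauli matrix `α` acting on the qubit of a qubit with ancilla. -/
def pauliExt (n : ℕ) (α : Fin 4) : Matrix (Fin 2 × Fin n) (Fin 2 × Fin n) ℂ :=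
  pauli α ⊗ₖ (1 : Matrix (Fin n) (Fin n) ℂ)

theorem isState_pauliExt {n : ℕ} {ξ : Matrix (Fin 2 × Fin n) (Fin 2 × Fin n) ℂ}
    (hξ : IsState ξ) (α : Fin 4) : IsState (pauliExt n α * ξ * pauliExt n α) := by
  refine hξ.conj ?_ ?_
  · unfold pauliExt Matrix.IsHermitian
    rw [Matrix.conjTranspose_kronecker, (pauli_isHermitian α).eq, Matrix.conjTranspose_one]
  · unfold pauliExt
    rw [← Matrix.mul_kronecker_mul, pauli_mul_self, one_mul, Matrix.one_kronecker_one]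

theorem extend_pauliChannel (q : Fin 4 → ℝ) {n : ℕ}
    (ξ : Matrix (Fin 2 × Fin n) (Fin 2 × Fin n) ℂ) :
    extend (pauliChannel q) ξ =
      ∑ α, (q α : ℂ) • (pauliExt n α * ξ * pauliExt n α) := by
  ext ⟨a, i⟩ ⟨b, j⟩
  simp only [extend, pauliChannel_apply, Matrix.of_apply, Matrix.sum_apply, Matrix.smul_apply]
  refine Finset.sum_congr rfl fun α _ => ?_
  congr 1
  simp [pauliExt, Matrix.mul_apply, Fintype.sum_prod_type, Matrix.kroneckerMap_apply,
    Matrix.one_apply]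

/-- The Bell projectors. -/
noncomputable def bell (α : Fin 4) : Matrix (Fin 2 × Fin 2) (Fin 2 × Fin 2) ℂ :=
  (1 / 2 : ℂ) • Matrix.vecMulVec (fun i => pauli α i.1 i.2) (star fun i => pauli α i.1 i.2)

theorem posSemidef_bell (α : Fin 4) : (bell α).PosSemidef :=
  (Matrix.posSemidef_vecMulVec_self_star _).smul (by norm_num [Complex.le_def])

theorem sum_bell : ∑ α, bell α = 1 := by
  ext ⟨a, i⟩ ⟨b, j⟩
  fin_cases a <;> fin_cases i <;> fin_cases b <;> fin_cases j <;>
    simp [bell, Fin.sum_univ_four, Matrix.vecMulVec_apply, pauli, Matrix.one_apply] <;> norm_num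

theorem outcomeProb_bell (α β : Fin 4) :
    outcomeProb (bell α) (bell β) = if α = β then 1 else 0 := by
  fin_cases α <;> fin_cases β <;>
    simp [outcomeProb, Matrix.trace, Matrix.mul_apply, bell, Matrix.vecMulVec_apply, pauli,
      Fintype.sum_prod_type, Fin.sum_univ_two] <;> norm_num

theorem isState_bell (α : Fin 4) : IsState (bell α) := by
  refine ⟨posSemidef_bell α, ?_⟩
  fin_cases α <;> simp [Matrix.trace, bell, Matrix.vecMulVec_apply, pauli,
      Fintype.sum_prod_type, Fin.sum_univ_two] <;> norm_num

/-- On this input the four errors produce orthogonal states, so a Bell measurement reads off the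
error index perfectly. -/
theorem pauliExt_conj_bell (α : Fin 4) : pauliExt 2 α * bell 0 * pauliExt 2 α = bell α := by
  ext ⟨a, i⟩ ⟨b, j⟩
  simp only [pauliExt, Matrix.mul_apply, Fintype.sum_prod_type, Matrix.kroneckerMap_apply,
    Matrix.one_apply, bell, Matrix.smul_apply, Matrix.vecMulVec_apply]
  rw [show star (fun i : Fin 2 × Fin 2 => pauli α i.1 i.2) (b, j) = pauli α j b from
    (pauli_isHermitian α).apply j b]
  fin_cases i <;> fin_cases j <;> simp [pauli, Fin.sum_univ_two] <;> ring

/-- Every test is realized on the maximally entangled state. -/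
theorem exists_povm_bell {x : Fin 4 → ℝ} (hx : x ∈ pauliTests) :
    ∃ M₁ M₂, IsBinaryPOVM M₁ M₂ ∧ ∀ α, outcomeProb (bell α) M₂ = x α := by
  rw [mem_pauliTests] at hx
  refine ⟨∑ α, ((1 - x α : ℝ) : ℂ) • bell α, ∑ α, (x α : ℂ) • bell α, ⟨?_, ?_, ?_⟩, ?_⟩
  · refine Matrix.posSemidef_sum _ fun α _ => (posSemidef_bell α).smul ?_
    exact_mod_cast sub_nonneg.2 (hx α).2
  · refine Matrix.posSemidef_sum _ fun α _ => (posSemidef_bell α).smul ?_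
    exact_mod_cast (hx α).1
  · rw [← Finset.sum_add_distrib, ← sum_bell]
    refine Finset.sum_congr rfl fun α _ => ?_
    rw [← add_smul]; simp
  · intro α
    have : outcomeProb (bell α) (∑ β, (x β : ℂ) • bell β) =
        ∑ β, x β * outcomeProb (bell α) (bell β) := by
      simp [outcomeProb, Finset.mul_sum, Matrix.trace_sum, Matrix.trace_smul]
    rw [this]
    simp [outcomeProb_bell]

/-- Values of an error functional `F` with an ancilla and over the tests have the same least
element. -/
theorem sInf_ancilla_eq {q₁ q₂ : Fin 4 → ℝ} (F : ℝ → ℝ → ℝ) {m : ℝ}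
    (hm : IsLeast ((fun x => F (∑ α, q₁ α * x α) (∑ α, q₂ α * (1 - x α))) '' pauliTests) m) :
    sInf {x | ∃ (n : ℕ) (ξ : Matrix (Fin 2 × Fin n) (Fin 2 × Fin n) ℂ), IsState ξ ∧
      x = sInf {y | ∃ M₁ M₂ : Matrix (Fin 2 × Fin n) (Fin 2 × Fin n) ℂ, IsBinaryPOVM M₁ M₂ ∧
        y = F (outcomeProb (extend (pauliChannel q₁) ξ) M₂)
          (outcomeProb (extend (pauliChannel q₂) ξ) M₁)}} = m := by
  -- Ancilla dimension and input state are bundled into one index, so that the infimum over both is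
  -- a single family.
  have key := sInf_setOf_sInf_eq (ι := Σ n : ℕ, Matrix (Fin 2 × Fin n) (Fin 2 × Fin n) ℂ)
    (P := fun i => IsState i.2)
    (B := fun i => {y | ∃ M₁ M₂ : Matrix (Fin 2 × Fin i.1) (Fin 2 × Fin i.1) ℂ,
      IsBinaryPOVM M₁ M₂ ∧ y = F (outcomeProb (extend (pauliChannel q₁) i.2) M₂)
        (outcomeProb (extend (pauliChannel q₂) i.2) M₁)}) hm
    (fun i _ => ⟨_, 1, 0, isBinaryPOVM_one_zero, rfl⟩) ?_ ?_
  · rw [← key]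
    congr 1
    ext x
    simp
  · rintro ⟨n, ξ⟩ hξ y ⟨M₁, M₂, hM, rfl⟩
    have hs := isState_pauliExt hξ
    refine ⟨_, mem_pauliTests_outcomeProb hs hM, ?_⟩
    simp only [extend_pauliChannel, outcomeProb_sum_smul, outcomeProb_add (hs _) hM]
  · obtain ⟨x, hx, rfl⟩ := hm.1
    obtain ⟨M₁, M₂, hM, h⟩ := exists_povm_bell hx
    refine ⟨⟨2, bell 0⟩, isState_bell 0, M₁, M₂, hM, ?_⟩
    simp only [extend_pauliChannel, outcomeProb_sum_smul, pauliExt_conj_bell,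
      outcomeProb_add (isState_bell _) hM, h]

theorem minimaxRisk_pauliChannel {q₁ q₂ : Fin 4 → ℝ} {m : ℝ}
    (hm : IsLeast (testRisk q₁ q₂ '' pauliTests) m) :
    minimaxRisk (pauliChannel q₁) (pauliChannel q₂) = m :=
  sInf_ancilla_eq max hm

theorem bayesRisk_pauliChannel {q₁ q₂ : Fin 4 → ℝ} {s m : ℝ}
    (hm : IsLeast (testBayes q₁ q₂ s '' pauliTests) m) :
    bayesRisk (pauliChannel q₁) (pauliChannel q₂) s = m :=
  sInf_ancilla_eq (fun a b => s * a + (1 - s) * b) hm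

/-! ### Bloch vectors: the risks without ancilla -/

section Qubit

/-- The point is `ρ ≤ 1`: for a qubit of unit trace, `1 - ρ` is the adjugate of `ρ`, which is
congruent to the transpose of `ρ`. -/
theorem outcomeProb_le_trace {ρ M : Matrix (Fin 2) (Fin 2) ℂ} (hρ : IsState ρ)
    (hM : M.PosSemidef) : outcomeProb ρ M ≤ M.trace.re := by
  have h1 : (1 - ρ).PosSemidef := by
    obtain ⟨a, b, c, d, rfl⟩ : ∃ a b c d, ρ = !![a, b; c, d] :=
      ⟨_, _, _, _, Matrix.eta_fin_two ρ⟩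
    have h := (hρ.1.transpose).mul_mul_conjTranspose_same (!![0, 1; -1, 0] : Matrix _ _ ℂ)
    have htr : a + d = 1 := by simpa [Matrix.trace_fin_two] using hρ.2
    have e : (1 : Matrix (Fin 2) (Fin 2) ℂ) - !![a, b; c, d] =
        !![0, 1; -1, 0] * !![a, b; c, d]ᵀ * (!![0, 1; -1, 0] : Matrix _ _ ℂ)ᴴ := by
      ext i j
      simp only [Matrix.mul_apply, Fin.sum_univ_two, Matrix.transpose_apply,
        Matrix.conjTranspose_apply]
      fin_cases i <;> fin_cases j <;> simp <;> linear_combination -htr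
    rwa [e]
  have h2 := outcomeProb_nonneg h1 hM
  simp only [outcomeProb, Matrix.sub_mul, one_mul, Matrix.trace_sub, Complex.sub_re] at h2 ⊢
  linarith

/-- Averaging over the Pauli matrices depolarizes completely: the four conjugates of a state add up
to twice the identity. -/
theorem sum_outcomeProb_pauli {ρ : Matrix (Fin 2) (Fin 2) ℂ} (hρ : IsState ρ)
    (M : Matrix (Fin 2) (Fin 2) ℂ) :
    ∑ α, outcomeProb (pauli α * ρ * pauli α) M = 2 * M.trace.re := by
  have h : ∑ α, pauli α * ρ * pauli α = (2 : ℂ) • (1 : Matrix (Fin 2) (Fin 2) ℂ) := by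
    obtain ⟨a, b, c, d, rfl⟩ : ∃ a b c d, ρ = !![a, b; c, d] :=
      ⟨_, _, _, _, Matrix.eta_fin_two ρ⟩
    have htr : a + d = 1 := by simpa [Matrix.trace_fin_two] using hρ.2
    ext i j
    fin_cases i <;> fin_cases j <;>
      simp [Fin.sum_univ_four, pauli] <;>
      ring_nf <;> simp <;> linear_combination 2 * htr
  have h2 := congrArg (fun A => (A * M).trace.re) h
  simpa [outcomeProb, Finset.sum_mul, Matrix.trace_sum, Matrix.trace_smul] using h2

/-- Each `x α` is at most the trace of `M₂`, which is half of the sum of all `x β`; the same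
argument for `M₁` handles `1 - x`. -/
theorem mem_localPauliTests_outcomeProb {ρ M₁ M₂ : Matrix (Fin 2) (Fin 2) ℂ}
    (hρ : IsState ρ) (h : IsBinaryPOVM M₁ M₂) :
    (fun α => outcomeProb (pauli α * ρ * pauli α) M₂) ∈ localPauliTests := by
  have hs := isState_pauli hρ
  refine ⟨mem_pauliTests_outcomeProb hs h, fun α => ?_, fun α => ?_⟩
  · rw [sum_outcomeProb_pauli hρ]
    have := outcomeProb_le_trace (hs α) h.2.1
    linarith
  · simp only [← outcomeProb_add (hs _) h]
    rw [sum_outcomeProb_pauli hρ]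
    have := outcomeProb_le_trace (hs α) h.1
    linarith

/-- The Hermitian matrix `b + c₁ σ_x + c₂ σ_y + c₃ σ_z`. -/
def bloch (b : ℝ) (c : Fin 3 → ℝ) : Matrix (Fin 2) (Fin 2) ℂ :=
  !![(b : ℂ) + c 2, c 0 - c 1 * Complex.I; c 0 + c 1 * Complex.I, (b : ℂ) - c 2]

/-- The trace is `2 * b` and the determinant is `b ^ 2 - ∑ i, c i ^ 2`, so neither eigenvalue can be
negative. -/
theorem posSemidef_bloch {b : ℝ} {c : Fin 3 → ℝ} (hb : 0 ≤ b) (h : ∑ i, c i ^ 2 ≤ b ^ 2) :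
    (bloch b c).PosSemidef := by
  rw [Fin.sum_univ_three] at h
  have hH : (bloch b c).IsHermitian := by
    ext i j
    fin_cases i <;> fin_cases j <;> simp [bloch, sub_eq_add_neg]
  refine hH.posSemidef_iff_eigenvalues_nonneg.2 ?_
  obtain ⟨e, he⟩ : ∃ e, e = hH.eigenvalues := ⟨_, rfl⟩
  have htr := hH.trace_eq_sum_eigenvalues
  have hdet := hH.det_eq_prod_eigenvalues
  rw [← he] at htr hdet ⊢
  rw [Fin.sum_univ_two, Matrix.trace_fin_two] at htr
  rw [Fin.prod_univ_two, Matrix.det_fin_two] at hdet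
  have htr := congrArg Complex.re htr
  have hdet := congrArg Complex.re hdet
  simp [bloch] at htr hdet
  have hd : 0 ≤ e 0 * e 1 := by rw [← hdet]; linarith
  intro i
  fin_cases i
  · change 0 ≤ e 0
    by_contra hc
    push Not at hc
    nlinarith
  · change 0 ≤ e 1
    by_contra hc
    push Not at hc
    nlinarith

/-- This is the equality case of Cauchy–Schwarz: it supplies Bloch vectors for state and effect with
prescribed products `v i`, the effect's vector having length only `∑ i, |v i|`. -/
theorem exists_unit_mul_eq (v : Fin 3 → ℝ) : ∃ n c : Fin 3 → ℝ, (∀ i, n i * c i = v i) ∧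
    ∑ i, n i ^ 2 ≤ 1 ∧ ∑ i, c i ^ 2 = (∑ i, |v i|) ^ 2 := by
  rcases (Finset.sum_nonneg fun i (_ : i ∈ Finset.univ) => abs_nonneg (v i)).eq_or_lt with hs | hs
  · have h0 : ∀ i, v i = 0 := fun i => by
      have := (Finset.sum_eq_zero_iff_of_nonneg fun i _ => abs_nonneg (v i)).1 hs.symm i
        (Finset.mem_univ i)
      simpa using this
    exact ⟨0, 0, by simp [h0], by simp, by simp [h0]⟩
  · set s := ∑ i, |v i| with hsdef
    refine ⟨fun i => SignType.sign (v i) * √(|v i| / s), fun i => √(s * |v i|),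
      fun i => ?_, ?_, ?_⟩
    · rw [mul_assoc, ← Real.sqrt_mul (by positivity),
        show |v i| / s * (s * |v i|) = |v i| ^ 2 by field_simp, Real.sqrt_sq (abs_nonneg _),
        sign_mul_abs]
    · calc ∑ i, ((SignType.sign (v i) : ℝ) * √(|v i| / s)) ^ 2 ≤ ∑ i, |v i| / s := by
            refine Finset.sum_le_sum fun i _ => ?_
            rw [mul_pow, Real.sq_sqrt (by positivity)]
            refine mul_le_of_le_one_left (by positivity) ?_
            rcases lt_trichotomy (v i) 0 with h | h | h <;> simp [h]
        _ = 1 := by rw [← Finset.sum_div, div_self hs.ne']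
    · calc ∑ i, √(s * |v i|) ^ 2 = ∑ i, s * |v i| :=
            Finset.sum_congr rfl fun i _ => Real.sq_sqrt (by positivity)
        _ = s ^ 2 := by rw [← Finset.mul_sum, ← hsdef, sq]

/-- Every test satisfying the inequalities of `localPauliTests` is realized on a qubit. -/
theorem exists_state_povm {x : Fin 4 → ℝ} (hx : x ∈ localPauliTests) :
    ∃ ρ M₁ M₂ : Matrix (Fin 2) (Fin 2) ℂ, IsState ρ ∧ IsBinaryPOVM M₁ M₂ ∧
      ∀ α, outcomeProb (pauli α * ρ * pauli α) M₂ = x α := by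
  obtain ⟨hx, h1, h2⟩ := hx
  rw [mem_pauliTests] at hx
  simp only [Fin.sum_univ_four, Fin.forall_fin_succ, Fin.isValue, Fin.succ_zero_eq_one,
    Fin.succ_one_eq_two, IsEmpty.forall_iff, and_true] at hx h1 h2
  -- Each nontrivial Pauli conjugation flips two of the three Bloch components, so `x α` must equal
  -- `b` plus a signed sum of the `n i * c i`. Inverting this sign matrix gives these values.
  obtain ⟨n, c, hnc, hn, hc⟩ := exists_unit_mul_eq ![(x 0 + x 1 - x 2 - x 3) / 4,
    (x 0 + x 2 - x 1 - x 3) / 4, (x 0 + x 3 - x 1 - x 2) / 4]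
  set b := (x 0 + x 1 + x 2 + x 3) / 4 with hb
  have hf : (Fin.succ 2 : Fin 4) = 3 := rfl
  rw [hf] at hx h1 h2
  -- Expanding the absolute values into sign patterns turns the two bounds into the sixteen
  -- inequalities that define `localPauliTests`.
  have hsb : ∑ i, |(![(x 0 + x 1 - x 2 - x 3) / 4, (x 0 + x 2 - x 1 - x 3) / 4,
      (x 0 + x 3 - x 1 - x 2) / 4] : Fin 3 → ℝ) i| ≤ min b (1 - b) := by
    simp only [Fin.sum_univ_three, Matrix.cons_val]
    rw [le_min_iff]
    constructor <;>
    rcases abs_cases ((x 0 + x 1 - x 2 - x 3) / 4) with h | h <;>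
    rcases abs_cases ((x 0 + x 2 - x 1 - x 3) / 4) with h' | h' <;>
    rcases abs_cases ((x 0 + x 3 - x 1 - x 2) / 4) with h'' | h'' <;> linarith
  have hs0 := Finset.sum_nonneg fun i (_ : i ∈ Finset.univ) => abs_nonneg
    ((![(x 0 + x 1 - x 2 - x 3) / 4, (x 0 + x 2 - x 1 - x 3) / 4,
      (x 0 + x 3 - x 1 - x 2) / 4] : Fin 3 → ℝ) i)
  refine ⟨bloch (1 / 2) fun i => n i / 2, bloch (1 - b) (-c), bloch b c,
    ⟨posSemidef_bloch (by norm_num) ?_, ?_⟩,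
    ⟨posSemidef_bloch (by linarith) ?_, posSemidef_bloch (by linarith) ?_, ?_⟩, ?_⟩
  · simp only [div_pow, ← Finset.sum_div]
    linarith
  · rw [Matrix.trace_fin_two]
    simp [bloch]
    norm_num
  · simp only [Pi.neg_apply, neg_sq]
    rw [hc]
    exact pow_le_pow_left₀ hs0 (hsb.trans (min_le_right _ _)) 2
  · rw [hc]
    exact pow_le_pow_left₀ hs0 (hsb.trans (min_le_left _ _)) 2
  · ext i j
    fin_cases i <;> fin_cases j <;> simp [bloch] <;> ring
  · have e0 := hnc 0
    have e1 := hnc 1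
    have e2 := hnc 2
    simp only [Fin.isValue, Matrix.cons_val] at e0 e1 e2
    intro α
    fin_cases α <;>
      simp [outcomeProb, Matrix.trace_fin_two, pauli, bloch]
    · linarith
    · linarith
    · linarith
    · linarith

theorem minimaxRiskNoAncilla_pauliChannel {q₁ q₂ : Fin 4 → ℝ} {m : ℝ}
    (hm : IsLeast (testRisk q₁ q₂ '' localPauliTests) m) :
    minimaxRiskNoAncilla (pauliChannel q₁) (pauliChannel q₂) = m := by
  refine sInf_setOf_sInf_eq hm (fun ρ _ => ⟨_, 1, 0, isBinaryPOVM_one_zero, rfl⟩) ?_ ?_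
  · rintro ρ hρ y ⟨M₁, M₂, hM, rfl⟩
    refine ⟨_, mem_localPauliTests_outcomeProb hρ hM, ?_⟩
    simp only [pauliChannel_apply, outcomeProb_sum_smul, outcomeProb_add (isState_pauli hρ _) hM,
      testRisk]
  · obtain ⟨x, hx, rfl⟩ := hm.1
    obtain ⟨ρ, M₁, M₂, hρ, hM, h⟩ := exists_state_povm hx
    refine ⟨ρ, hρ, M₁, M₂, hM, ?_⟩
    simp only [pauliChannel_apply, outcomeProb_sum_smul, outcomeProb_add (isState_pauli hρ _) hM,
      testRisk, h]

/-- Ancilla-free tests supported on two indices determine the sums of two weights; the pairs 01, 02,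
12 and 03 already determine all four weights. -/
theorem pauliChannel_injective : Function.Injective pauliChannel := by
  intro q₁ q₂ hq
  have key : ∀ x ∈ localPauliTests, ∑ α, q₁ α * x α = ∑ α, q₂ α * x α := by
    intro x hx
    obtain ⟨ρ, M₁, M₂, hρ, hM, h⟩ := exists_state_povm hx
    have := congrArg (fun E => outcomeProb (E ρ) M₂) hq
    simpa only [pauliChannel_apply, outcomeProb_sum_smul, h] using this
  have h (x : Fin 4 → ℝ) (hx : x ∈ localPauliTests) := key x hx
  have h01 := h ![1, 1, 0, 0] (by
    simp [localPauliTests, mem_pauliTests, Fin.forall_fin_succ, Fin.sum_univ_four]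
    norm_num)
  have h02 := h ![1, 0, 1, 0] (by
    simp [localPauliTests, mem_pauliTests, Fin.forall_fin_succ, Fin.sum_univ_four]
    norm_num)
  have h12 := h ![0, 1, 1, 0] (by
    simp [localPauliTests, mem_pauliTests, Fin.forall_fin_succ, Fin.sum_univ_four]
    norm_num)
  have h03 := h ![1, 0, 0, 1] (by
    simp [localPauliTests, mem_pauliTests, Fin.forall_fin_succ, Fin.sum_univ_four]
    norm_num)
  simp [Fin.sum_univ_four] at h01 h02 h12 h03
  ext α
  fin_cases α <;> simp <;> linarith

end Qubit

/-! ### Neyman–Pearson theory and worst priors -/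

/-- A likelihood ratio test with threshold `s`, randomized on ties. -/
def IsThresholdTest (p : Fin 4 → ℝ) (s : ℝ) (x : Fin 4 → ℝ) : Prop :=
  ∀ α, (p α < s → x α = 0) ∧ (s < p α → x α = 1)

/-- Weighted median: `k` is where the weights summed from the top first reach half of the total, and
randomizing at `k` makes the weight exactly one. -/
theorem exists_median_test {t : Fin 4 → ℝ} (ht : ∀ α, 0 < t α) (hsum : ∑ α, t α = 2) :
    ∃ k, ∃ x ∈ pauliTests, (∀ j < k, x j = 0) ∧ (∀ j, k < j → x j = 1) ∧
      ∑ α, t α * x α = 1 := by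
  simp only [mem_pauliTests, Fin.sum_univ_four] at *
  have h0 := ht 0
  have h1 := ht 1
  have h2 := ht 2
  have h3 := ht 3
  have aux : ∀ {u v : ℝ}, 0 < u → 0 ≤ v → v ≤ u → 0 ≤ v / u ∧ v / u ≤ 1 :=
    fun hu hv huv => ⟨div_nonneg hv hu.le, (div_le_one hu).2 huv⟩
  by_cases c3 : 1 ≤ t 3
  · refine ⟨3, ![0, 0, 0, 1 / t 3], ?_, ?_, ?_, ?_⟩
    · simpa [Fin.forall_fin_succ] using aux h3 zero_le_one c3
    · simp [Fin.forall_fin_succ]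
    · simp [Fin.forall_fin_succ]
    · simp [h3.ne']
  by_cases c2 : 1 ≤ t 2 + t 3
  · refine ⟨2, ![0, 0, (1 - t 3) / t 2, 1], ?_, ?_, ?_, ?_⟩
    · simpa [Fin.forall_fin_succ] using aux (v := 1 - t 3) h2 (by linarith) (by linarith)
    · simp [Fin.forall_fin_succ]
    · simp [Fin.forall_fin_succ]
    · simp [mul_div_cancel₀ _ h2.ne']
  by_cases c1 : 1 ≤ t 1 + t 2 + t 3
  · refine ⟨1, ![0, (1 - t 2 - t 3) / t 1, 1, 1], ?_, ?_, ?_, ?_⟩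
    · simpa [Fin.forall_fin_succ] using aux (v := 1 - t 2 - t 3) h1 (by linarith) (by linarith)
    · simp
    · simp [Fin.forall_fin_succ]
    · simp [mul_div_cancel₀ _ h1.ne']
      ring
  · refine ⟨0, ![(1 - t 1 - t 2 - t 3) / t 0, 1, 1, 1], ?_, ?_, ?_, ?_⟩
    · simpa [Fin.forall_fin_succ] using
        aux (v := 1 - t 1 - t 2 - t 3) h0 (by linarith) (by linarith)
    · simp
    · simp [Fin.forall_fin_succ]
    · simp [mul_div_cancel₀ _ h0.ne']
      ring

section Threshold

variable {a b t p : Fin 4 → ℝ}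

theorem testBayes_sub (ha : ∀ α, a α = t α * (1 - p α)) (hb : ∀ α, b α = t α * p α) (s : ℝ)
    (x y : Fin 4 → ℝ) :
    testBayes a b s y - testBayes a b s x = ∑ α, t α * ((y α - x α) * (s - p α)) := by
  simp only [testBayes, Finset.mul_sum, ← Finset.sum_add_distrib, ← Finset.sum_sub_distrib]
  refine Finset.sum_congr rfl fun α _ => ?_
  rw [ha, hb]
  ring

theorem IsThresholdTest.mul_nonneg {s : ℝ} {x y : Fin 4 → ℝ} (hx : IsThresholdTest p s x)
    (hy : y ∈ pauliTests) (α : Fin 4) : 0 ≤ (y α - x α) * (s - p α) := by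
  have hy := mem_pauliTests.1 hy α
  rcases lt_trichotomy (p α) s with h | h | h
  · rw [(hx α).1 h]
    exact _root_.mul_nonneg (by linarith) (by linarith)
  · simp [h]
  · rw [(hx α).2 h]
    exact mul_nonneg_of_nonpos_of_nonpos (by linarith) (by linarith)

/-- Neyman–Pearson: threshold tests minimize the mean error probability. -/
theorem IsThresholdTest.testBayes_le (ht : ∀ α, 0 < t α) (ha : ∀ α, a α = t α * (1 - p α))
    (hb : ∀ α, b α = t α * p α) {s : ℝ} {x y : Fin 4 → ℝ} (hx : IsThresholdTest p s x)
    (hy : y ∈ pauliTests) : testBayes a b s x ≤ testBayes a b s y := by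
  rw [← sub_nonneg, testBayes_sub ha hb]
  exact Finset.sum_nonneg fun α _ => _root_.mul_nonneg (ht α).le (hx.mul_nonneg hy α)

/-- Only threshold tests minimize the mean error probability. -/
theorem IsThresholdTest.of_testBayes_le (ht : ∀ α, 0 < t α) (ha : ∀ α, a α = t α * (1 - p α))
    (hb : ∀ α, b α = t α * p α) {s : ℝ} {x y : Fin 4 → ℝ} (hx : IsThresholdTest p s x)
    (hy : y ∈ pauliTests) (h : testBayes a b s y ≤ testBayes a b s x) :
    IsThresholdTest p s y := by
  have hnn : ∀ α ∈ Finset.univ, 0 ≤ t α * ((y α - x α) * (s - p α)) :=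
    fun α _ => _root_.mul_nonneg (ht α).le (hx.mul_nonneg hy α)
  have h0 : ∑ α, t α * ((y α - x α) * (s - p α)) = 0 :=
    le_antisymm (by rw [← testBayes_sub ha hb]; linarith) (Finset.sum_nonneg hnn)
  intro α
  have hα := (Finset.sum_eq_zero_iff_of_nonneg hnn).1 h0 α (Finset.mem_univ α)
  simp only [mul_eq_zero, (ht α).ne', false_or, sub_eq_zero] at hα
  constructor
  · intro hlt
    rw [hα.resolve_right hlt.ne', (hx α).1 hlt]
  · intro hlt
    rw [hα.resolve_right hlt.ne, (hx α).2 hlt]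

theorem exists_isThresholdTest (p : Fin 4 → ℝ) (s : ℝ) :
    ∃ x ∈ pauliTests, IsThresholdTest p s x := by
  refine ⟨fun α => if s < p α then 1 else 0, mem_pauliTests.2 fun α => ?_, fun α => ?_⟩
  · split_ifs <;> norm_num
  · exact ⟨fun h => if_neg h.not_gt, fun h => if_pos h⟩

/-- The two error probabilities agree exactly for the tests of weight one. -/
theorem sum_mul_eq_iff (ha : ∀ α, a α = t α * (1 - p α)) (hb : ∀ α, b α = t α * p α)
    (hsum : ∑ α, b α = 1) (x : Fin 4 → ℝ) :
    ∑ α, a α * x α = ∑ α, b α * (1 - x α) ↔ ∑ α, t α * x α = 1 := by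
  have h : ∑ α, a α * x α - ∑ α, b α * (1 - x α) = ∑ α, t α * x α - ∑ α, b α := by
    simp only [← Finset.sum_sub_distrib]
    refine Finset.sum_congr rfl fun α _ => ?_
    rw [ha, hb]
    ring
  constructor <;> intro h' <;> linarith

theorem testBayes_le_testRisk {s : ℝ} (hs : s ∈ Set.Icc (0 : ℝ) 1) (x : Fin 4 → ℝ) :
    testBayes a b s x ≤ testRisk a b x := by
  have h1 := mul_le_mul_of_nonneg_left
    (le_max_left (∑ α, a α * x α) (∑ α, b α * (1 - x α))) hs.1
  have h2 := mul_le_mul_of_nonneg_left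
    (le_max_right (∑ α, a α * x α) (∑ α, b α * (1 - x α))) (sub_nonneg.2 hs.2)
  unfold testBayes testRisk
  linarith

theorem testRisk_eq_testBayes {x : Fin 4 → ℝ}
    (h : ∑ α, a α * x α = ∑ α, b α * (1 - x α)) (s : ℝ) :
    testRisk a b x = testBayes a b s x := by
  unfold testBayes testRisk
  rw [h, max_self]
  ring

variable {R : ℝ → ℝ}

/-- A balanced threshold test exists at one of the likelihood ratios. -/
theorem exists_balanced_threshold (ht : ∀ α, 0 < t α) (hsum : ∑ α, t α = 2) (hp : Monotone p) :
    ∃ k, ∃ x ∈ pauliTests, IsThresholdTest p (p k) x ∧ ∑ α, t α * x α = 1 := by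
  obtain ⟨k, x, hx, h0, h1, h⟩ := exists_median_test ht hsum
  exact ⟨k, x, hx, fun α => ⟨fun hα => h0 α (hp.reflect_lt hα), fun hα => h1 α (hp.reflect_lt hα)⟩,
    h⟩

theorem IsThresholdTest.bayes_eq (ht : ∀ α, 0 < t α) (ha : ∀ α, a α = t α * (1 - p α))
    (hb : ∀ α, b α = t α * p α) {s r : ℝ} (hr : IsLeast (testBayes a b s '' pauliTests) r)
    {x : Fin 4 → ℝ} (hx : x ∈ pauliTests) (h : IsThresholdTest p s x) :
    testBayes a b s x = r := by
  refine le_antisymm ?_ (hr.2 ⟨x, hx, rfl⟩)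
  obtain ⟨y, hy, rfl⟩ := hr.1
  exact h.testBayes_le ht ha hb hy

/-- A balanced threshold test sits at a worst prior. -/
theorem isMaxOn_of_balanced (ht : ∀ α, 0 < t α) (ha : ∀ α, a α = t α * (1 - p α))
    (hb : ∀ α, b α = t α * p α) (hbsum : ∑ α, b α = 1)
    (hR : ∀ s, IsLeast (testBayes a b s '' pauliTests) (R s)) {s : ℝ} {x : Fin 4 → ℝ}
    (hx : x ∈ pauliTests) (h : IsThresholdTest p s x) (h1 : ∑ α, t α * x α = 1) :
    IsMaxOn R (Set.Icc 0 1) s := by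
  intro u _
  have he := (sum_mul_eq_iff ha hb hbsum x).2 h1
  change R u ≤ R s
  rw [← h.bayes_eq ht ha hb (hR s) hx, ← testRisk_eq_testBayes he s, testRisk_eq_testBayes he u]
  exact (hR u).2 ⟨x, hx, rfl⟩

/-- At a worst prior there is a balanced threshold test, the Bayes risk is the minimax risk, and
the minimax tests are the balanced threshold tests. -/
theorem minimax_of_isMaxOn (ht : ∀ α, 0 < t α) (hsum : ∑ α, t α = 2) (hp : Monotone p)
    (hp01 : ∀ α, p α ∈ Set.Icc (0 : ℝ) 1)
    (ha : ∀ α, a α = t α * (1 - p α)) (hb : ∀ α, b α = t α * p α)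
    (hann : ∀ α, 0 ≤ a α) (hbnn : ∀ α, 0 ≤ b α) (hbsum : ∑ α, b α = 1)
    (hR : ∀ s, IsLeast (testBayes a b s '' pauliTests) (R s)) {s : ℝ}
    (hs : s ∈ Set.Icc (0 : ℝ) 1) (hmax : IsMaxOn R (Set.Icc 0 1) s) :
    (∃ x ∈ pauliTests, IsThresholdTest p s x ∧ ∑ α, t α * x α = 1) ∧
    IsLeast (testRisk a b '' pauliTests) (R s) ∧
    ∀ x ∈ pauliTests, testRisk a b x ≤ R s ↔ IsThresholdTest p s x ∧ ∑ α, t α * x α = 1 := by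
  have hiff : ∀ x ∈ pauliTests,
      testRisk a b x ≤ R s ↔ IsThresholdTest p s x ∧ ∑ α, t α * x α = 1 := by
    intro x hx
    constructor
    · intro h
      obtain ⟨y, hy, hyt⟩ := exists_isThresholdTest p s
      have hyR := hyt.bayes_eq ht ha hb (hR s) hy
      refine ⟨hyt.of_testBayes_le ht ha hb hx ?_, ?_⟩
      · rw [hyR]
        exact (testBayes_le_testRisk hs x).trans h
      · rw [← sum_mul_eq_iff ha hb hbsum]
        have hx' := mem_pauliTests.1 hx
        have n1 : 0 ≤ ∑ α, a α * x α :=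
          Finset.sum_nonneg fun α _ => mul_nonneg (hann α) (hx' α).1
        have n2 : 0 ≤ ∑ α, b α * (1 - x α) :=
          Finset.sum_nonneg fun α _ => mul_nonneg (hbnn α) (sub_nonneg.2 (hx' α).2)
        obtain ⟨m1, m2⟩ := max_le_iff.1 h
        have h3 := (hR s).2 ⟨x, hx, rfl⟩
        unfold testBayes at h3
        -- At an endpoint prior the mean error sees only one error probability, but there the Bayes
        -- risk is at most zero, which forces both to vanish. At an interior prior, two numbers
        -- bounded by `R s` whose weighted mean is at least `R s` both equal it.
        rcases eq_or_lt_of_le hs.1 with h0 | h0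
        · have hb0 : ∑ α, b α * (1 - x α) = R s := by
            rw [← h0] at h3 m2 ⊢
            linarith
          have hR0 : R s ≤ 0 := by
            have := (hR s).2 ⟨fun _ => 1, mem_pauliTests.2 fun _ => by norm_num, rfl⟩
            simpa [testBayes, ← h0] using this
          linarith
        rcases eq_or_lt_of_le hs.2 with h1 | h1
        · have hR0 : R s ≤ 0 := by
            have := (hR s).2 ⟨fun _ => 0, mem_pauliTests.2 fun _ => by norm_num, rfl⟩
            simpa [testBayes, h1] using this
          linarith
        · have e1 : R s ≤ ∑ α, a α * x α := by
            by_contra hc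
            push Not at hc
            nlinarith
          have e2 : R s ≤ ∑ α, b α * (1 - x α) := by
            by_contra hc
            push Not at hc
            nlinarith
          linarith
    · rintro ⟨h, h1⟩
      have he := (sum_mul_eq_iff ha hb hbsum x).2 h1
      rw [testRisk_eq_testBayes he s, h.bayes_eq ht ha hb (hR s) hx]
  obtain ⟨k, x, hx, hxt, hx1⟩ := exists_balanced_threshold ht hsum hp
  have he := (sum_mul_eq_iff ha hb hbsum x).2 hx1
  have hle : testRisk a b x ≤ R s := by
    rw [testRisk_eq_testBayes he (p k), hxt.bayes_eq ht ha hb (hR _) hx]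
    exact hmax (hp01 k)
  have hlb : R s ∈ lowerBounds (testRisk a b '' pauliTests) := by
    rintro _ ⟨y, hy, rfl⟩
    exact ((hR s).2 ⟨y, hy, rfl⟩).trans (testBayes_le_testRisk hs y)
  exact ⟨⟨x, hx, (hiff x hx).1 hle⟩,
    ⟨⟨x, hx, le_antisymm hle (hlb ⟨x, hx, rfl⟩)⟩, hlb⟩, hiff⟩

end Threshold

/-! ### Symmetry under exchange of the channels -/

/-- The test obtained by exchanging the hypotheses and reversing the order of the indices. -/
def reverseTest (x : Fin 4 → ℝ) : Fin 4 → ℝ := fun α => 1 - x α.rev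

theorem sum_rev (f : Fin 4 → ℝ) : ∑ α : Fin 4, f α.rev = ∑ α, f α :=
  Equiv.sum_comp Fin.revPerm f

theorem reverseTest_mem_pauliTests {x : Fin 4 → ℝ} (hx : x ∈ pauliTests) :
    reverseTest x ∈ pauliTests := by
  rw [mem_pauliTests] at *
  intro α
  have := hx α.rev
  constructor <;> simp only [reverseTest] <;> linarith

theorem reverseTest_mem_localPauliTests {x : Fin 4 → ℝ} (hx : x ∈ localPauliTests) :
    reverseTest x ∈ localPauliTests := by
  obtain ⟨h, h1, h2⟩ := hx
  refine ⟨reverseTest_mem_pauliTests h, fun α => ?_, fun α => ?_⟩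
  · simpa only [reverseTest, sum_rev fun β => 1 - x β] using h2 α.rev
  · simpa only [reverseTest, sub_sub_cancel, sum_rev x] using h1 α.rev

theorem IsThresholdTest.reverse {p : Fin 4 → ℝ} {s : ℝ} {x : Fin 4 → ℝ}
    (h : IsThresholdTest p s x) :
    IsThresholdTest (fun α => 1 - p α.rev) (1 - s) (reverseTest x) := by
  intro α
  constructor
  · intro hα
    simp [reverseTest, (h α.rev).2 (by linarith)]
  · intro hα
    simp [reverseTest, (h α.rev).1 (by linarith)]

theorem sum_mul_reverseTest {t : Fin 4 → ℝ} (hsum : ∑ α, t α = 2) {x : Fin 4 → ℝ}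
    (h : ∑ α, t α * x α = 1) : ∑ α, t α.rev * reverseTest x α = 1 := by
  simp only [reverseTest]
  rw [sum_rev fun α => t α * (1 - x α)]
  simp only [mul_sub, mul_one, Finset.sum_sub_distrib, hsum, h]
  norm_num

theorem mem_localPauliTests_iff {x : Fin 4 → ℝ} : x ∈ localPauliTests ↔
    ((0 ≤ x 0 ∧ x 0 ≤ 1) ∧ (0 ≤ x 1 ∧ x 1 ≤ 1) ∧ (0 ≤ x 2 ∧ x 2 ≤ 1) ∧ 0 ≤ x 3 ∧ x 3 ≤ 1) ∧
    (x 0 ≤ x 1 + x 2 + x 3 ∧ x 1 ≤ x 0 + x 2 + x 3 ∧ x 2 ≤ x 0 + x 1 + x 3 ∧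
      x 3 ≤ x 0 + x 1 + x 2) ∧
    x 1 + x 2 + x 3 ≤ 2 + x 0 ∧ x 0 + x 2 + x 3 ≤ 2 + x 1 ∧ x 0 + x 1 + x 3 ≤ 2 + x 2 ∧
      x 0 + x 1 + x 2 ≤ 2 + x 3 := by
  simp only [localPauliTests, Set.mem_ofPred_eq, mem_pauliTests, Fin.sum_univ_four]
  constructor
  · rintro ⟨h, h1, h2⟩
    refine ⟨⟨h 0, h 1, h 2, h 3⟩, ⟨?_, ?_, ?_, ?_⟩, ?_, ?_, ?_, ?_⟩
    · linarith [h1 0]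
    · linarith [h1 1]
    · linarith [h1 2]
    · linarith [h1 3]
    · linarith [h2 0]
    · linarith [h2 1]
    · linarith [h2 2]
    · linarith [h2 3]
  · rintro ⟨⟨h0, h1, h2, h3⟩, ⟨k0, k1, k2, k3⟩, l0, l1, l2, l3⟩
    refine ⟨fun α => ?_, fun α => ?_, fun α => ?_⟩
    · fin_cases α <;> assumption
    · fin_cases α <;> simp <;> linarith
    · fin_cases α <;> simp <;> linarith

/-! ### Balanced threshold tests that need no ancilla -/

section Exceptional

variable {t p : Fin 4 → ℝ} {s : ℝ}

/-- The threshold fixes all coordinates except the tied ones; in each case the tied values can be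
chosen to satisfy both balance and the ancilla-free inequalities. -/
theorem exists_local_of_exceptionalCase (ht : ∀ α, 0 < t α) (hsum : ∑ α, t α = 2)
    (hp : Monotone p) (hx : ∃ x ∈ pauliTests, IsThresholdTest p s x ∧ ∑ α, t α * x α = 1)
    (h : ExceptionalCase t p s) :
    ∃ x ∈ localPauliTests, IsThresholdTest p s x ∧ ∑ α, t α * x α = 1 := by
  obtain ⟨y, hy, hyt, hy1⟩ := hx
  rw [mem_pauliTests] at hy
  simp only [Fin.sum_univ_four] at hsum hy1 ⊢
  have t0 := ht 0
  have t1 := ht 1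
  have t2 := ht 2
  have t3 := ht 3
  have p01 : p 0 ≤ p 1 := hp (by decide)
  have p12 : p 1 ≤ p 2 := hp (by decide)
  have p23 : p 2 ≤ p 3 := hp (by decide)
  have thr : ∀ x : Fin 4 → ℝ, ((p 0 < s → x 0 = 0) ∧ (s < p 0 → x 0 = 1)) →
      ((p 1 < s → x 1 = 0) ∧ (s < p 1 → x 1 = 1)) →
      ((p 2 < s → x 2 = 0) ∧ (s < p 2 → x 2 = 1)) →
      ((p 3 < s → x 3 = 0) ∧ (s < p 3 → x 3 = 1)) → IsThresholdTest p s x := by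
    intro x h0 h1 h2 h3 α
    fin_cases α <;> assumption
  rcases h with ⟨h0, h1, h2⟩ | ⟨h0, h1, h2, h3, h4⟩ | ⟨h0, h1, h2, h3⟩ | ⟨h0, h1, h2, h3, h4⟩
  · have y2 := (hyt 2).2 (by linarith)
    have y3 := (hyt 3).2 (by linarith)
    rw [y2, y3] at hy1
    have := mul_nonneg t0.le (hy 0).1
    have := mul_nonneg t1.le (hy 1).1
    -- With `x 2 = x 3 = 1` the inequalities force `x 0 = x 1`, and balance determines the common
    -- value.
    obtain ⟨z, hz⟩ : ∃ z, z = (1 - t 2 - t 3) / (t 0 + t 1) := ⟨_, rfl⟩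
    have hz0 : 0 ≤ z := by rw [hz]; apply div_nonneg <;> linarith
    have hz1 : z ≤ 1 := by rw [hz, div_le_one] <;> linarith
    have hz2 : z * (t 0 + t 1) = 1 - t 2 - t 3 := by
      rw [hz, div_mul_cancel₀]; linarith
    refine ⟨![z, z, 1, 1], mem_localPauliTests_iff.2 ?_, thr _ ?_ ?_ ?_ ?_, ?_⟩
    · simp only [Matrix.cons_val]
      refine ⟨⟨⟨?_, ?_⟩, ⟨?_, ?_⟩, ⟨?_, ?_⟩, ?_, ?_⟩, ⟨?_, ?_, ?_, ?_⟩, ?_, ?_, ?_, ?_⟩ <;>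
        linarith
    all_goals simp only [Matrix.cons_val]
    · constructor <;> intro <;> first | trivial | linarith
    · constructor <;> intro <;> first | trivial | linarith
    · constructor <;> intro <;> first | trivial | linarith
    · constructor <;> intro <;> first | trivial | linarith
    · linarith
  -- With `x 3 = 1` the tied values must sum to at least one. Since the weights sum to two, `h4`
  -- says that the lightest tied index fits: `t 3` plus its weight is at most one. That index gets
  -- the value one, and the other two share the `z` fixed by balance.
  · have key : ∀ {u v : ℝ}, 0 < u → u + t 3 ≤ 1 → u + v + t 3 = 2 → ∃ z : ℝ, 0 ≤ z ∧ z ≤ 1 ∧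
        z * v = 1 - t 3 - u := by
      intro u v hu h1 h2
      have hv : 0 < v := by linarith
      exact ⟨(1 - t 3 - u) / v, div_nonneg (by linarith) hv.le, (div_le_one hv).2 (by linarith),
        div_mul_cancel₀ _ hv.ne'⟩
    rcases min_choice (t 0) (min (t 1) (t 2)) with hm | hm
    · rw [hm] at h4
      obtain ⟨z, hz0, hz1, hz⟩ := key (v := t 1 + t 2) t0 (by linarith) (by linarith)
      refine ⟨![1, z, z, 1], mem_localPauliTests_iff.2 ?_, thr _ ?_ ?_ ?_ ?_, ?_⟩
      · simp only [Matrix.cons_val]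
        refine ⟨⟨⟨?_, ?_⟩, ⟨?_, ?_⟩, ⟨?_, ?_⟩, ?_, ?_⟩, ⟨?_, ?_, ?_, ?_⟩, ?_, ?_, ?_, ?_⟩ <;>
          linarith
      all_goals simp only [Matrix.cons_val]
      · constructor <;> intro <;> first | trivial | linarith
      · constructor <;> intro <;> first | trivial | linarith
      · constructor <;> intro <;> first | trivial | linarith
      · constructor <;> intro <;> first | trivial | linarith
      · linarith
    rw [hm] at h4
    rcases min_choice (t 1) (t 2) with hm | hm
    · rw [hm] at h4
      obtain ⟨z, hz0, hz1, hz⟩ := key (v := t 0 + t 2) t1 (by linarith) (by linarith)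
      refine ⟨![z, 1, z, 1], mem_localPauliTests_iff.2 ?_, thr _ ?_ ?_ ?_ ?_, ?_⟩
      · simp only [Matrix.cons_val]
        refine ⟨⟨⟨?_, ?_⟩, ⟨?_, ?_⟩, ⟨?_, ?_⟩, ?_, ?_⟩, ⟨?_, ?_, ?_, ?_⟩, ?_, ?_, ?_, ?_⟩ <;>
          linarith
      all_goals simp only [Matrix.cons_val]
      · constructor <;> intro <;> first | trivial | linarith
      · constructor <;> intro <;> first | trivial | linarith
      · constructor <;> intro <;> first | trivial | linarith
      · constructor <;> intro <;> first | trivial | linarith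
      · linarith
    · rw [hm] at h4
      obtain ⟨z, hz0, hz1, hz⟩ := key (v := t 0 + t 1) t2 (by linarith) (by linarith)
      refine ⟨![z, z, 1, 1], mem_localPauliTests_iff.2 ?_, thr _ ?_ ?_ ?_ ?_, ?_⟩
      · simp only [Matrix.cons_val]
        refine ⟨⟨⟨?_, ?_⟩, ⟨?_, ?_⟩, ⟨?_, ?_⟩, ?_, ?_⟩, ⟨?_, ?_, ?_, ?_⟩, ?_, ?_, ?_, ?_⟩ <;>
          linarith
      all_goals simp only [Matrix.cons_val]
      · constructor <;> intro <;> first | trivial | linarith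
      · constructor <;> intro <;> first | trivial | linarith
      · constructor <;> intro <;> first | trivial | linarith
      · constructor <;> intro <;> first | trivial | linarith
      · linarith
  · refine ⟨![0, 0, 1, 1], mem_localPauliTests_iff.2 ?_, thr _ ?_ ?_ ?_ ?_, ?_⟩
    · simp only [Matrix.cons_val]
      norm_num
    all_goals simp only [Matrix.cons_val]
    · constructor <;> intro <;> first | trivial | linarith
    · constructor <;> intro <;> first | trivial | linarith
    · constructor <;> intro <;> first | trivial | linarith
    · constructor <;> intro <;> first | trivial | linarith
    · linarith
  -- With `x 0 = 0` and `x 3 = 1` the inequalities force `x 1 + x 2 = 1`; this `z` balances the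
  -- test. If `t 1 = t 2`, balance does not depend on `z`.
  · obtain ⟨z, hz0, hz1, hz⟩ : ∃ z : ℝ, 0 ≤ z ∧ z ≤ 1 ∧ z * (t 1 - t 2) = 1 - t 3 - t 2 := by
      rcases eq_or_ne (t 1) (t 2) with he | he
      · rw [he, sub_self, abs_zero, abs_nonpos_iff] at h4
        exact ⟨0, le_rfl, zero_le_one, by linarith⟩
      · have hd : t 1 - t 2 ≠ 0 := sub_ne_zero.2 he
        have h5 : |(t 0 - t 3) / (t 1 - t 2)| ≤ 1 := by
          rw [abs_div]
          exact (div_le_one (abs_pos.2 hd)).2 h4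
        obtain ⟨h6, h7⟩ := abs_le.1 h5
        refine ⟨((t 0 - t 3) / (t 1 - t 2) + 1) / 2, by linarith, by linarith, ?_⟩
        field_simp
        linarith
    refine ⟨![0, z, 1 - z, 1], mem_localPauliTests_iff.2 ?_, thr _ ?_ ?_ ?_ ?_, ?_⟩
    · simp only [Matrix.cons_val]
      refine ⟨⟨⟨?_, ?_⟩, ⟨?_, ?_⟩, ⟨?_, ?_⟩, ?_, ?_⟩, ⟨?_, ?_, ?_, ?_⟩, ?_, ?_, ?_, ?_⟩ <;>
        linarith
    all_goals simp only [Matrix.cons_val]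
    · constructor <;> intro <;> first | trivial | linarith
    · constructor <;> intro <;> first | trivial | linarith
    · constructor <;> intro <;> first | trivial | linarith
    · constructor <;> intro <;> first | trivial | linarith
    · linarith

/-- Up to reversal the threshold is `p 0`, or it is `p 1` strictly between `p 0` and `p 3`. The
alternative `p 0 = p 3` is the case of equal channels. -/
theorem exceptionalCase_of_exists_local (ht : ∀ α, 0 < t α) (hsum : ∑ α, t α = 2)
    (hp : Monotone p) (hs : s = p 0 ∨ p 0 < s ∧ s = p 1 ∧ p 1 < p 3)
    (hx : ∃ x ∈ localPauliTests, IsThresholdTest p s x ∧ ∑ α, t α * x α = 1) :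
    p 0 = p 3 ∨ ExceptionalCase t p s := by
  obtain ⟨x, hx, hxt, hx1⟩ := hx
  obtain ⟨⟨x0, x1, x2, x3⟩, ⟨k0, k1, k2, k3⟩, l0, l1, l2, l3⟩ := mem_localPauliTests_iff.1 hx
  simp only [Fin.sum_univ_four] at hsum hx1
  have t0 := ht 0
  have t1 := ht 1
  have t2 := ht 2
  have t3 := ht 3
  have p01 : p 0 ≤ p 1 := hp (by decide)
  have p12 : p 1 ≤ p 2 := hp (by decide)
  have p23 : p 2 ≤ p 3 := hp (by decide)
  rcases hs with hs | ⟨hs0, hs1, hs3⟩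
  · rcases p01.eq_or_lt with e01 | e01
    · rcases p12.eq_or_lt with e12 | e12
      · rcases p23.eq_or_lt with e23 | e23
        · left; linarith
        · right; right; left
          refine ⟨hs, e01, e12, e23, ?_⟩
          rw [(hxt 3).2 (by linarith)] at hx1 k3
          -- The tied values sum to at least one by `k3`, so their total weight `1 - t 3` is at
          -- least the smallest tied weight.
          set m := min (t 0) (min (t 1) (t 2)) with hm
          have m0 : m ≤ t 0 := min_le_left _ _
          have m1 : m ≤ t 1 := (min_le_right _ _).trans (min_le_left _ _)
          have m2 : m ≤ t 2 := (min_le_right _ _).trans (min_le_right _ _)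
          have mp : 0 < m := lt_min t0 (lt_min t1 t2)
          have q0 := mul_le_mul_of_nonneg_right m0 x0.1
          have q1 := mul_le_mul_of_nonneg_right m1 x1.1
          have q2 := mul_le_mul_of_nonneg_right m2 x2.1
          have q3 := mul_le_mul_of_nonneg_left k3 mp.le
          linarith
      · exact Or.inr (Or.inl ⟨hs, e01, e12⟩)
    · exfalso
      -- Three coordinates equal to one force the fourth to be one, and the weight is then two
      -- instead of one.
      rw [(hxt 1).2 (by linarith), (hxt 2).2 (by linarith), (hxt 3).2 (by linarith)] at hx1 l0
      have : x 0 = 1 := by linarith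
      rw [this] at hx1
      linarith
  · right; right; right
    rcases p12.eq_or_lt with e12 | e12
    · right
      refine ⟨hs0, hs1, e12, by linarith, ?_⟩
      rw [(hxt 0).1 hs0, (hxt 3).2 (by linarith)] at hx1 l0 k3
      have hx2 : x 2 = 1 - x 1 := by linarith
      have : t 0 - t 3 = (t 1 - t 2) * (2 * x 1 - 1) := by
        rw [hx2] at hx1
        linarith
      rw [this, abs_mul]
      exact mul_le_of_le_one_right (abs_nonneg _) (abs_le.2 ⟨by linarith, by linarith⟩)
    · left
      refine ⟨hs0, hs1, e12, ?_⟩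
      rw [(hxt 0).1 hs0, (hxt 2).2 (by linarith), (hxt 3).2 (by linarith)] at hx1 l0
      have : x 1 = 0 := by linarith
      rw [this] at hx1
      linarith

theorem monotone_reverse (hp : Monotone p) : Monotone fun α : Fin 4 => 1 - p α.rev := fun α β h => by
  have := hp (Fin.rev_le_rev.2 h)
  simp only
  linarith

/-- A balanced threshold test that needs no ancilla exists exactly in the exceptional cases. -/
theorem exists_local_iff (ht : ∀ α, 0 < t α) (hsum : ∑ α, t α = 2) (hp : Monotone p)
    (hs : s ∈ Set.range p)
    (hx : ∃ x ∈ pauliTests, IsThresholdTest p s x ∧ ∑ α, t α * x α = 1) :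
    (∃ x ∈ localPauliTests, IsThresholdTest p s x ∧ ∑ α, t α * x α = 1) ↔
      p 0 = p 3 ∨ ExceptionalCase t p s ∨
        ExceptionalCase (fun α => t α.rev) (fun α => 1 - p α.rev) (1 - s) := by
  have hsum' : ∑ α : Fin 4, t α.rev = 2 := by rw [sum_rev, hsum]
  have p01 : p 0 ≤ p 1 := hp (by decide)
  have p12 : p 1 ≤ p 2 := hp (by decide)
  have p23 : p 2 ≤ p 3 := hp (by decide)
  constructor
  · intro h
    -- Every breakpoint falls under one of the two forms that reversal interchanges.
    have hk : (s = p 0 ∨ p 0 < s ∧ s = p 1 ∧ p 1 < p 3) ∨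
        (s = p 3 ∨ s < p 3 ∧ s = p 2 ∧ p 0 < p 2) := by
      obtain ⟨k, rfl⟩ := hs
      fin_cases k
      · exact Or.inl (Or.inl rfl)
      · change (p 1 = p 0 ∨ p 0 < p 1 ∧ p 1 = p 1 ∧ p 1 < p 3) ∨
          (p 1 = p 3 ∨ p 1 < p 3 ∧ p 1 = p 2 ∧ p 0 < p 2)
        rcases p01.eq_or_lt with h1 | h1
        · exact Or.inl (Or.inl h1.symm)
        · rcases (p12.trans p23).eq_or_lt with h2 | h2
          · exact Or.inr (Or.inl h2)
          · exact Or.inl (Or.inr ⟨h1, rfl, h2⟩)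
      · change (p 2 = p 0 ∨ p 0 < p 2 ∧ p 2 = p 1 ∧ p 1 < p 3) ∨
          (p 2 = p 3 ∨ p 2 < p 3 ∧ p 2 = p 2 ∧ p 0 < p 2)
        rcases p23.eq_or_lt with h1 | h1
        · exact Or.inr (Or.inl h1)
        · rcases (p01.trans p12).eq_or_lt with h2 | h2
          · exact Or.inl (Or.inl h2.symm)
          · exact Or.inr (Or.inr ⟨h1, rfl, h2⟩)
      · exact Or.inr (Or.inl rfl)
    rcases hk with hk | hk
    · rcases exceptionalCase_of_exists_local ht hsum hp hk h with h | h
      · exact Or.inl h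
      · exact Or.inr (Or.inl h)
    · obtain ⟨x, hx, hxt, hx1⟩ := h
      have hk' : 1 - s = 1 - p 3 ∨ 1 - p 3 < 1 - s ∧ 1 - s = 1 - p 2 ∧ 1 - p 2 < 1 - p 0 := by
        rcases hk with hk | ⟨h1, h2, h3⟩
        · left; linarith
        · right; refine ⟨?_, ?_, ?_⟩ <;> linarith
      rcases exceptionalCase_of_exists_local (t := fun α => t α.rev) (s := 1 - s)
        (fun α => ht α.rev) hsum' (monotone_reverse hp) hk'
        ⟨_, reverseTest_mem_localPauliTests hx, hxt.reverse, sum_mul_reverseTest hsum hx1⟩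
        with h | h
      · change 1 - p 3 = 1 - p 0 at h
        left; linarith
      · exact Or.inr (Or.inr h)
  · rintro (h | h | h)
    · refine ⟨_, half_mem_localPauliTests, fun α => ?_, ?_⟩
      · obtain ⟨k, rfl⟩ := hs
        have hc : ∀ j, p j = p 0 := fun j =>
          le_antisymm ((hp (Fin.le_last j)).trans h.ge) (hp (Fin.zero_le j))
        simp [hc α, hc k]
      · rw [← Finset.sum_mul, hsum]
        norm_num
    · exact exists_local_of_exceptionalCase ht hsum hp hx h
    · obtain ⟨x, hx, hxt, hx1⟩ := hx
      obtain ⟨y, hy, hyt, hy1⟩ := exists_local_of_exceptionalCase (fun α => ht α.rev) hsum'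
        (monotone_reverse hp) ⟨_, reverseTest_mem_pauliTests hx, hxt.reverse,
          sum_mul_reverseTest hsum hx1⟩ h
      refine ⟨_, reverseTest_mem_localPauliTests hy, ?_, ?_⟩
      · simpa using hyt.reverse
      · simpa using sum_mul_reverseTest hsum' hy1

end Exceptional

/-! ### Relabelling the Pauli indices, and conclusion -/

theorem comp_mem_pauliTests (π : Equiv.Perm (Fin 4)) {x : Fin 4 → ℝ} (hx : x ∈ pauliTests) :
    x ∘ π ∈ pauliTests :=
  mem_pauliTests.2 fun α => mem_pauliTests.1 hx (π α)

/-- The four indices play symmetric roles in the ancilla-free inequalities, so sorting the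
likelihood ratios costs no generality. -/
theorem comp_mem_localPauliTests (π : Equiv.Perm (Fin 4)) {x : Fin 4 → ℝ}
    (hx : x ∈ localPauliTests) : x ∘ π ∈ localPauliTests := by
  refine ⟨comp_mem_pauliTests π hx.1, fun α => ?_, fun α => ?_⟩
  · exact (hx.2.1 (π α)).trans_eq (Equiv.sum_comp π x).symm
  · exact (hx.2.2 (π α)).trans_eq (Equiv.sum_comp π fun β => 1 - x β).symm

theorem testRisk_comp (π : Equiv.Perm (Fin 4)) (q₁ q₂ x : Fin 4 → ℝ) :
    testRisk (q₁ ∘ π) (q₂ ∘ π) (x ∘ π) = testRisk q₁ q₂ x := by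
  have h1 := Equiv.sum_comp π fun α => q₁ α * x α
  have h2 := Equiv.sum_comp π fun α => q₂ α * (1 - x α)
  simp only [testRisk, Function.comp_apply, h1, h2]

theorem testBayes_comp (π : Equiv.Perm (Fin 4)) (q₁ q₂ x : Fin 4 → ℝ) (s : ℝ) :
    testBayes (q₁ ∘ π) (q₂ ∘ π) s (x ∘ π) = testBayes q₁ q₂ s x := by
  have h1 := Equiv.sum_comp π fun α => q₁ α * x α
  have h2 := Equiv.sum_comp π fun α => q₂ α * (1 - x α)
  simp only [testBayes, Function.comp_apply, h1, h2]

theorem image_comp_perm {S : Set (Fin 4 → ℝ)} {f g : (Fin 4 → ℝ) → ℝ}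
    (hS : ∀ (π : Equiv.Perm (Fin 4)) (x), x ∈ S → x ∘ π ∈ S) (π : Equiv.Perm (Fin 4))
    (hfg : ∀ x, g (x ∘ π) = f x) : f '' S = g '' S := by
  ext y
  constructor
  · rintro ⟨x, hx, rfl⟩
    exact ⟨x ∘ π, hS π x hx, hfg x⟩
  · rintro ⟨x, hx, rfl⟩
    refine ⟨x ∘ π.symm, hS π.symm x hx, ?_⟩
    rw [← hfg, Function.comp_assoc, Equiv.symm_comp_self, Function.comp_id]

theorem theorem5 (q₁ q₂ : Fin 4 → ℝ)
    (hq₁ : ∀ α, 0 ≤ q₁ α) (hq₂ : ∀ α, 0 ≤ q₂ α)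
    (hsum₁ : ∑ α, q₁ α = 1) (hsum₂ : ∑ α, q₂ α = 1)
    (hpos : ∀ α, 0 < q₁ α + q₂ α)
    (π : Equiv.Perm (Fin 4)) (t p : Fin 4 → ℝ)
    (ht : ∀ α, t α = q₁ (π α) + q₂ (π α))
    (hp : ∀ α, p α = q₂ (π α) / t α)
    (hmono : Monotone p) :
    (∃ α, p α ∈ Set.Icc (0 : ℝ) 1 ∧
      IsMaxOn (bayesRisk (pauliChannel q₁) (pauliChannel q₂)) (Set.Icc 0 1) (p α)) ∧
    ∀ ps : ℝ, ps ∈ Set.range p →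
      IsMaxOn (bayesRisk (pauliChannel q₁) (pauliChannel q₂)) (Set.Icc 0 1) ps →
      (¬ Exceptional (pauliChannel q₁) (pauliChannel q₂) t p ps →
        minimaxRisk (pauliChannel q₁) (pauliChannel q₂) <
          minimaxRiskNoAncilla (pauliChannel q₁) (pauliChannel q₂)) ∧
      (Exceptional (pauliChannel q₁) (pauliChannel q₂) t p ps →
        minimaxRiskNoAncilla (pauliChannel q₁) (pauliChannel q₂) =
          minimaxRisk (pauliChannel q₁) (pauliChannel q₂)) := by
  have htpos : ∀ α, 0 < t α := fun α => ht α ▸ hpos (π α)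
  have hb : ∀ α, (q₂ ∘ π) α = t α * p α := fun α => by
    rw [hp, mul_div_cancel₀ _ (htpos α).ne', Function.comp_apply]
  have ha : ∀ α, (q₁ ∘ π) α = t α * (1 - p α) := fun α => by
    have := hb α
    simp only [Function.comp_apply] at *
    linarith [ht α]
  have hbsum : ∑ α, (q₂ ∘ π) α = 1 := (Equiv.sum_comp π q₂).trans hsum₂
  have hasum : ∑ α, (q₁ ∘ π) α = 1 := (Equiv.sum_comp π q₁).trans hsum₁
  have htsum : ∑ α, t α = 2 := by
    simp only [Function.comp_apply] at hasum hbsum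
    simp only [ht, Finset.sum_add_distrib, hasum, hbsum]
    norm_num
  have hp01 : ∀ α, p α ∈ Set.Icc (0 : ℝ) 1 := fun α => by
    rw [hp]
    exact ⟨div_nonneg (hq₂ _) (htpos α).le,
      (div_le_one (htpos α)).2 (by linarith [ht α, hq₁ (π α)])⟩
  have hne : pauliTests.Nonempty := ⟨_, half_mem_localPauliTests.1⟩
  have hR : ∀ s, IsLeast (testBayes (q₁ ∘ π) (q₂ ∘ π) s '' pauliTests)
      (bayesRisk (pauliChannel q₁) (pauliChannel q₂) s) := by
    intro s
    rw [← image_comp_perm (fun π _ => comp_mem_pauliTests π) π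
      fun x => testBayes_comp π q₁ q₂ x s]
    obtain ⟨r, hr⟩ := (isCompact_pauliTests.image (continuous_testBayes q₁ q₂ s)).exists_isLeast
      (hne.image _)
    rwa [bayesRisk_pauliChannel hr]
  have hL : IsLeast (testRisk (q₁ ∘ π) (q₂ ∘ π) '' localPauliTests)
      (minimaxRiskNoAncilla (pauliChannel q₁) (pauliChannel q₂)) := by
    rw [← image_comp_perm (fun π _ => comp_mem_localPauliTests π) π
      fun x => testRisk_comp π q₁ q₂ x]
    obtain ⟨r, hr⟩ := (isCompact_localPauliTests.image (continuous_testRisk q₁ q₂)).exists_isLeast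
      (Set.Nonempty.image _ ⟨_, half_mem_localPauliTests⟩)
    rwa [minimaxRiskNoAncilla_pauliChannel hr]
  refine ⟨?_, fun ps hps hmax => ?_⟩
  · obtain ⟨k, x, hx, hxt, hx1⟩ := exists_balanced_threshold htpos htsum hmono
    exact ⟨k, hp01 k, isMaxOn_of_balanced htpos ha hb hbsum hR hx hxt hx1⟩
  have hps01 : ps ∈ Set.Icc (0 : ℝ) 1 := by
    obtain ⟨k, rfl⟩ := hps
    exact hp01 k
  obtain ⟨hex, hleast, hiff⟩ := minimax_of_isMaxOn htpos htsum hmono hp01 ha hb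
    (fun α => hq₁ (π α)) (fun α => hq₂ (π α)) hbsum hR hps01 hmax
  have hM : minimaxRisk (pauliChannel q₁) (pauliChannel q₂) =
      bayesRisk (pauliChannel q₁) (pauliChannel q₂) ps := by
    rw [← image_comp_perm (fun π _ => comp_mem_pauliTests π) π
      fun x => testRisk_comp π q₁ q₂ x] at hleast
    exact minimaxRisk_pauliChannel hleast
  -- By monotonicity `p 0 = p 3` makes all ratios equal, and normalization of `q₂` makes the common
  -- value one half.
  have heq : pauliChannel q₁ = pauliChannel q₂ ↔ p 0 = p 3 := by
    rw [pauliChannel_injective.eq_iff]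
    constructor
    · rintro rfl
      have h : ∀ α, p α = 1 / 2 := fun α => by
        have := htpos α
        rw [hp, div_eq_div_iff this.ne' two_ne_zero, ht]
        ring
      rw [h, h]
    · intro h
      have hc : ∀ j, p j = p 0 := fun j =>
        le_antisymm ((hmono (Fin.le_last j)).trans h.ge) (hmono (Fin.zero_le j))
      have h0 : p 0 = 1 / 2 := by
        simp only [hb, hc, ← Finset.sum_mul, htsum] at hbsum
        linarith
      ext α
      have h1 := ha (π.symm α)
      have h2 := hb (π.symm α)
      simp only [Function.comp_apply, Equiv.apply_symm_apply, hc, h0] at h1 h2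
      linarith
  -- The ancilla-free minimum is attained, so this inequality says that some ancilla-free test is
  -- minimax among all tests.
  have hmain : Exceptional (pauliChannel q₁) (pauliChannel q₂) t p ps ↔
      minimaxRiskNoAncilla (pauliChannel q₁) (pauliChannel q₂) ≤
        minimaxRisk (pauliChannel q₁) (pauliChannel q₂) := by
    rw [Exceptional, heq, ← exists_local_iff htpos htsum hmono hps hex, hM]
    constructor
    · rintro ⟨x, hx, h⟩
      exact (hL.2 ⟨x, hx, rfl⟩).trans ((hiff x hx.1).2 h)
    · intro h
      obtain ⟨x, hx, hxr⟩ := hL.1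
      exact ⟨x, hx, (hiff x hx.1).1 (hxr.trans_le h)⟩
  refine ⟨fun h => not_le.1 fun hle => h (hmain.2 hle), fun h => le_antisymm (hmain.1 h) ?_⟩
  rw [hM]
  obtain ⟨x, hx, hxr⟩ := hL.1
  rw [← hxr]
  exact hleast.2 ⟨x, hx.1, rfl⟩
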